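/- Let $E$ and $F$ be finite-dimensional real Hilbert spaces (for instance $\mathbb{R}^n$ and $\mathbb{R}^m$). Let $f:E\to\mathbb{R}$ be convex and continuously differentiable, let $g:F\to\mathbb{R}\cup\{+\infty\}$ be proper, lower semicontinuous and convex, put $\operatorname{dom} g:=\{z\in F: g(z)<\infty\}$ and $$\operatorname{hzn} g:=\{v\in F:\ g(z+v)\le g(z)\ \text{for all } z\in\operatorname{dom} g\},$$ and let $c:E\to F$ be continuously differentiable with $$c(\lambda x+(1-\lambda)x')-\lambda c(x)-(1-\lambda)c(x')\in\operatorname{hzn} g\qquad\text{for all } x,x'\in E,\ \lambda\in[0,1].$$ Assume that the problem $$\text{(P)}\qquad \text{minimize } \Phi(x):=f(x)+g(c(x)),\quad x\in E,$$ is feasible and has a minimizer, and let $\Phi^*$ be its minimal value. For $x\in E$, let $$\mathcal{Y}(x):=\{y\in\partial g(c(x)):\ \nabla f(x)+c'(x)^\top y=0\}$$ be the set of multipliers associated with $x$, where $\partial g$ denotes the convex subdifferential ($\partial g(u)=\emptyset$ for $u\notin\operatorname{dom} g$). A point $x$ is called stationary if $\mathcal{Y}(x)\neq\emptyset$. Suppose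 that (P) has a stationary minimizer $\tilde x$, and let $Y_{\rm mul}:=\mathcal{Y}(\tilde x)$. For $\mu>0$, let $$\mathcal{L}_\mu(x,y):=f(x)+\inf_{z\in F}\Big\{g(z)+\langle y,c(x)-z\rangle+\tfrac{1}{2\mu}\|c(x)-z\|^2\Big\}$$ be the augmented Lagrangian, and let $\operatorname{prox}_{\mu g}(u)$ be the unique minimizer of $w\mapsto g(w)+\frac1{2\mu}\|w-u\|^2$. Given $\mu_0>0$, $y^0\in F$ and $\beta\in(0,1)$, let $\{(x^k,z^k,y^k)\}$ be generated by the classical augmented Lagrangian method: for $k=0,1,2,\dots$, 1. select $\varepsilon_k\ge 0$ and $x^k\in E$ such that $\mathcal{L}_{\mu_k}(x^k,y^k)\le\inf_{x\in E}\mathcal{L}_{\mu_k}(x,y^k)+\varepsilon_k$; 2. set $z^k:=\operatorname{prox}_{\mu_k g}(c(x^k)+\mu_k y^k)$; 3. set $y^{k+1}:=y^k+\mu_k^{-1}\,[c(x^k)-z^k]$; 4. set $\mu_{k+1}:=\beta_k\mu_k$ for some $\beta_k\in(0,\beta]\cup\{1\}$. Assume that $\sum_{k=0}^\infty\sqrt{\varepsilon_k/\mu_k}<\infty$.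 Then $\{y^k\}$ converges to some vector in $Y_{\rm mul}$, $c(x^k)-z^k\to 0$, and $$\limsup_{k\to\infty}\big(f(x^k)+g(z^k)\big)\le\Phi^*.$$ Moreover, each accumulation point of $\{x^k\}$ is a minimizer of (P), and for each infinite set $K\subseteq\{0,1,2,\dots\}$ and each $\bar x\in E$ such that $x^k\to\bar x$ as $K\ni k\to\infty$, also $z^k\to c(\bar x)$ and $f(x^k)+g(z^k)\to\Phi^*$ as $K\ni k\to\infty$. -/

import Mathlib

open Filter Topology Set
open scoped InnerProductSpace

section ExtendedValued

variable {F : Type*} [NormedAddCommGroup F] [InnerProductSpace ℝ F]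

/-- The effective domain `dom φ` of an extended-real-valued function. -/
def effDomain (φ : F → EReal) : Set F := {z | φ z < ⊤}

/-- `φ` is proper: it never takes the value `-∞` and its domain is nonempty. -/
def IsProperFun (φ : F → EReal) : Prop :=
  (effDomain φ).Nonempty ∧ ∀ z, φ z ≠ ⊥

/-- `φ` is convex: its epigraph is a convex subset of `F × ℝ`. -/
def IsConvexFun (φ : F → EReal) : Prop :=
  Convex ℝ {p : F × ℝ | φ p.1 ≤ (p.2 : EReal)}

/-- The convex subdifferential `∂φ(a)`, empty at points outside of `dom φ`. -/
def subdiff (φ : F → EReal) (a : F) : Set F :=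
  {y | a ∈ effDomain φ ∧
    ∀ z ∈ effDomain φ, φ a + ((⟪y, z - a⟫_ℝ : ℝ) : EReal) ≤ φ z}

/-- The horizon `hzn φ`: all directions along which `φ` never increases. -/
def horizon (φ : F → EReal) : Set F :=
  {v | ∀ z ∈ effDomain φ, φ (z + v) ≤ φ z}

/-- `p = prox_{γφ}(a)`: the point `p` minimizes `w ↦ φ w + ‖w - a‖² / (2γ)`. For proper, lower
semicontinuous, convex `φ` and `γ > 0` there is exactly one such point. -/
def IsProx (φ : F → EReal) (γ : ℝ) (a p : F) : Prop :=
  ∀ w, φ p + ((1 / (2 * γ) * ‖p - a‖ ^ 2 : ℝ) : EReal)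
    ≤ φ w + ((1 / (2 * γ) * ‖w - a‖ ^ 2 : ℝ) : EReal)

end ExtendedValued

/-- The data of the composite problem `minimize f(x) + g(c(x))` over `x`. -/
structure CompositeProblem (E F : Type*) where
  /-- smooth part of the objective -/
  f : E → ℝ
  /-- extended-valued outer function -/
  g : F → EReal
  /-- inner map -/
  c : E → F

namespace CompositeProblem

variable {E F : Type*} [NormedAddCommGroup E] [InnerProductSpace ℝ E]
  [NormedAddCommGroup F] [InnerProductSpace ℝ F]

/-- The objective `Φ(x) = f(x) + g(c(x))`. -/
noncomputable def obj (P : CompositeProblem E F) (x : E) : EReal := (P.f x : EReal) + P.g (P.c x)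

/-- The optimal value `Φ* = inf Φ`. -/
noncomputable def optVal (P : CompositeProblem E F) : EReal := ⨅ x, P.obj x

/-- `a` is a (global) minimizer of the problem; in particular it is feasible. -/
def IsMinimizer (P : CompositeProblem E F) (a : E) : Prop :=
  P.obj a < ⊤ ∧ ∀ x, P.obj a ≤ P.obj x

/-- The standing assumptions of fully convex composite optimization. -/
structure IsFullyConvex (P : CompositeProblem E F) : Prop where
  f_contDiff : ContDiff ℝ 1 P.f
  f_convex : ConvexOn ℝ univ P.f
  g_proper : IsProperFun P.g
  g_lsc : LowerSemicontinuous P.g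
  g_convex : IsConvexFun P.g
  c_contDiff : ContDiff ℝ 1 P.c
  /-- `c` is convex with respect to the cone `-hzn g` -/
  c_convex : ∀ (x x' : E) (t : ℝ), t ∈ Icc (0 : ℝ) 1 →
    P.c (t • x + (1 - t) • x') - t • P.c x - (1 - t) • P.c x' ∈ horizon P.g
  exists_minimizer : ∃ a, P.IsMinimizer a

/-- The set `𝒴(a)` of multipliers associated with `a`: all `y ∈ ∂g(c(a))` with `∇ₓ𝓛(a, y) = 0`,
where `𝓛(x, y) = f(x) + ⟨y, c(x)⟩ - g*(y)` is the Lagrangian. The term `g*(y)` does not depend on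
`x` (and is finite for `y ∈ ∂g(c(a))`), so it does not enter the derivative. -/
def multipliers (P : CompositeProblem E F) (a : E) : Set F :=
  {y | y ∈ subdiff P.g (P.c a) ∧
    HasFDerivAt (fun x => P.f x + ⟪y, P.c x⟫_ℝ) (0 : E →L[ℝ] ℝ) a}

/-- `a` is stationary: some multiplier is associated with it. Feasibility of `a` is implied. -/
def IsStationary (P : CompositeProblem E F) (a : E) : Prop := (P.multipliers a).Nonempty

/-- The augmented Lagrangian
`𝓛_μ(x, y) = f(x) + inf_z {g(z) + ⟨y, c(x) - z⟩ + ‖c(x) - z‖² / (2μ)}`. -/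
noncomputable def augLagrangian (P : CompositeProblem E F) (μ : ℝ) (x : E) (y : F) : EReal :=
  (P.f x : EReal) +
    ⨅ z, (P.g z + ((⟪y, P.c x - z⟫_ℝ + 1 / (2 * μ) * ‖P.c x - z‖ ^ 2 : ℝ) : EReal))

/-- The sequences are generated by the classical (inexact) augmented Lagrangian method with
penalty parameters `μ k`, tolerances `ε k` and reduction constant `β`; the starting data are
`μ 0` and `y 0`. -/
structure IsClassicalALM (P : CompositeProblem E F) (β : ℝ) (μ ε : ℕ → ℝ)
    (x : ℕ → E) (z y : ℕ → F) : Prop where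
  β_mem : β ∈ Ioo (0 : ℝ) 1
  μ_zero_pos : 0 < μ 0
  ε_nonneg : ∀ k, 0 ≤ ε k
  /-- the subproblem is solved up to `ε k` -/
  subproblem : ∀ k, P.augLagrangian (μ k) (x k) (y k)
    ≤ (⨅ x', P.augLagrangian (μ k) x' (y k)) + (ε k : EReal)
  /-- `z k = prox_{μ_k g}(c(x k) + μ_k y k)` -/
  prox_step : ∀ k, IsProx P.g (μ k) (P.c (x k) + μ k • y k) (z k)
  dual_step : ∀ k, y (k + 1) = y k + (μ k)⁻¹ • (P.c (x k) - z k)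
  penalty_step : ∀ k, ∃ b ∈ Ioc (0 : ℝ) β ∪ {1}, μ (k + 1) = b * μ k

end CompositeProblem

/-! The augmented Lagrangian method is an inexact proximal point method on the dual. Let `S` be the
set of pairs (perturbation of the constraint map, attainable value); it is convex
(`convex_perturbedValues`), and the multipliers at a minimizer are exactly the slopes of affine
minorants of `S` with intercept `Φ` (`mem_multipliers_iff`). Approximate minimization of the
augmented Lagrangian is approximate minimization of `proxValue` over `S`. The infimum need not be
attained, but minimizing sequences have Cauchy first components, whose limit `u` defines an exact
dual step.

The exact step is firmly Fejér monotone with respect to every multiplier, and the actual step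
differs from it by at most `√(2 ε / μ)` (`exists_exact_dual_step`). Summability makes all distances
to multipliers converge, so the steps vanish, a cluster point is a multiplier, and the whole
sequence converges to it. Primal claims follow by comparison with `(0, Φ)` and lower semicontinuity.
-/

/-! ### One dual proximal step on a convex set of pairs. -/

section ProximalStep

variable {F : Type*} [NormedAddCommGroup F] [InnerProductSpace ℝ F]

/-- The value `r - ⟨y, u⟩ + ‖u‖² / (2μ)` of a point `p = (u, r)` in the proximal subproblem. -/
noncomputable def proxValue (μ : ℝ) (y : F) (p : F × ℝ) : ℝ :=
  p.2 - ⟪y, p.1⟫_ℝ + 1 / (2 * μ) * ‖p.1‖ ^ 2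

theorem proxValue_combo (μ : ℝ) (y : F) (p q : F × ℝ) (t : ℝ) :
    proxValue μ y (t • p + (1 - t) • q) =
      t * proxValue μ y p + (1 - t) * proxValue μ y q
        - t * (1 - t) * (1 / (2 * μ) * ‖p.1 - q.1‖ ^ 2) := by
  have h1 : ‖t • p.1 + (1 - t) • q.1‖ ^ 2 =
      t ^ 2 * ‖p.1‖ ^ 2 + 2 * (t * (1 - t)) * ⟪p.1, q.1⟫_ℝ + (1 - t) ^ 2 * ‖q.1‖ ^ 2 := by
    rw [norm_add_sq_real, norm_smul, norm_smul, inner_smul_left, inner_smul_right, mul_pow,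
      mul_pow, Real.norm_eq_abs, Real.norm_eq_abs, sq_abs, sq_abs]
    simp only [conj_trivial]
    ring
  have h2 : ‖p.1 - q.1‖ ^ 2 = ‖p.1‖ ^ 2 - 2 * ⟪p.1, q.1⟫_ℝ + ‖q.1‖ ^ 2 := norm_sub_sq_real _ _
  simp only [proxValue, Prod.fst_add, Prod.smul_fst, Prod.snd_add, Prod.smul_snd, h1, h2,
    inner_add_right, inner_smul_right, smul_eq_mul]
  ring

/-- Existence of the proximal point for a convex set of pairs `(u, r)`, which need not be closed:
the infimum `m` of the proximal objective grows quadratically away from the point `u`, and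
affine minorants of the set carry over to `u`. -/
theorem exists_proximal_point [CompleteSpace F] {S : Set (F × ℝ)} (hS : Convex ℝ S)
    (hne : S.Nonempty) {μ : ℝ} (hμ : 0 < μ) (y : F) {B : ℝ}
    (hB : ∀ p ∈ S, B ≤ proxValue μ y p) :
    ∃ (m : ℝ) (u : F),
      (∀ p ∈ S, m + 1 / (2 * μ) * ‖p.1 - u‖ ^ 2 ≤ proxValue μ y p) ∧
      (∀ b : ℝ, (∀ p ∈ S, b ≤ proxValue μ y p) → b ≤ m) ∧
      ∀ (b : ℝ) (w : F), (∀ p ∈ S, b + ⟪w, p.1⟫_ℝ ≤ p.2) →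
        b + ⟪w - y, u⟫_ℝ + 1 / (2 * μ) * ‖u‖ ^ 2 ≤ m := by
  set m := sInf (proxValue μ y '' S) with hm
  have hbdd : BddBelow (proxValue μ y '' S) := ⟨B, by rintro _ ⟨p, hp, rfl⟩; exact hB p hp⟩
  have hle : ∀ p ∈ S, m ≤ proxValue μ y p := fun p hp => csInf_le hbdd ⟨p, hp, rfl⟩
  have hcombo : ∀ p ∈ S, ∀ q ∈ S, ∀ t : ℝ, 0 ≤ t → t ≤ 1 →
      m + t * (1 - t) * (1 / (2 * μ) * ‖p.1 - q.1‖ ^ 2) ≤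
        t * proxValue μ y p + (1 - t) * proxValue μ y q := by
    intro p hp q hq t h0 h1
    have := hle _ (hS hp hq h0 (sub_nonneg.2 h1) (by ring))
    rw [proxValue_combo] at this
    linarith
  obtain ⟨v, -, hvlim, hvS⟩ := exists_seq_tendsto_sInf (hne.image (proxValue μ y)) hbdd
  choose s hs hsv using hvS
  have hslim : Tendsto (fun n => proxValue μ y (s n)) atTop (𝓝 m) := by
    simpa only [hsv] using hvlim
  have hcauchy : CauchySeq (fun n => (s n).1) := by
    rw [Metric.cauchySeq_iff']
    intro δ hδ
    have hη : 0 < δ ^ 2 / (16 * μ) := by positivity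
    obtain ⟨N, hN⟩ := eventually_atTop.1
      (hslim.eventually (gt_mem_nhds (show m < m + δ ^ 2 / (16 * μ) by linarith)))
    refine ⟨N, fun n hn => ?_⟩
    -- Strong convexity at the midpoint: two nearly optimal points have close first components.
    have h := hcombo _ (hs n) _ (hs N) (1 / 2) (by norm_num) (by norm_num)
    have hn' := hN n hn
    have hN' := hN N le_rfl
    rw [dist_eq_norm]
    have h3 : 1 / 4 * (1 / (2 * μ) * ‖(s n).1 - (s N).1‖ ^ 2) < δ ^ 2 / (16 * μ) := by
      linarith
    have h4 : ‖(s n).1 - (s N).1‖ ^ 2 < δ ^ 2 := by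
      have h5 : 1 / 4 * (1 / (2 * μ) * ‖(s n).1 - (s N).1‖ ^ 2) * (8 * μ) <
          δ ^ 2 / (16 * μ) * (8 * μ) := by gcongr
      field_simp at h5
      nlinarith [sq_nonneg δ]
    exact lt_of_pow_lt_pow_left₀ 2 hδ.le h4
  obtain ⟨u, hu⟩ := cauchySeq_tendsto_of_complete hcauchy
  refine ⟨m, u, fun p hp => ?_, fun b hb => ?_, fun b w hw => ?_⟩
  -- Combine `p` with weight `t` and the minimizing sequence, divide by `t`, then let `t` tend to
  -- `0` to recover the full quadratic growth.
  · have ht : ∀ t : ℝ, 0 < t → t ≤ 1 →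
        m + (1 - t) * (1 / (2 * μ) * ‖p.1 - u‖ ^ 2) ≤ proxValue μ y p := by
      intro t h0 h1
      have hl : Tendsto (fun n => m + t * (1 - t) * (1 / (2 * μ) * ‖p.1 - (s n).1‖ ^ 2)) atTop
          (𝓝 (m + t * (1 - t) * (1 / (2 * μ) * ‖p.1 - u‖ ^ 2))) :=
        ((((hu.const_sub p.1).norm.pow 2).const_mul _).const_mul _).const_add _
      have hr : Tendsto (fun n => t * proxValue μ y p + (1 - t) * proxValue μ y (s n)) atTop
          (𝓝 (t * proxValue μ y p + (1 - t) * m)) := (hslim.const_mul _).const_add _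
      have h := le_of_tendsto_of_tendsto' hl hr fun n => hcombo _ hp _ (hs n) t h0.le h1
      have h' : t * (m + (1 - t) * (1 / (2 * μ) * ‖p.1 - u‖ ^ 2)) ≤ t * proxValue μ y p := by
        linarith
      exact le_of_mul_le_mul_left h' h0
    have hl : Tendsto (fun t : ℝ => m + (1 - t) * (1 / (2 * μ) * ‖p.1 - u‖ ^ 2)) (𝓝[>] 0)
        (𝓝 (m + (1 - 0) * (1 / (2 * μ) * ‖p.1 - u‖ ^ 2))) := by
      refine Tendsto.mono_left (Continuous.tendsto ?_ 0) nhdsWithin_le_nhds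
      fun_prop
    have := le_of_tendsto hl (by
      filter_upwards [Ioo_mem_nhdsGT (zero_lt_one' ℝ)] with t h using ht t h.1 h.2.le)
    simpa using this
  · exact le_csInf (hne.image _) (by rintro _ ⟨p, hp, rfl⟩; exact hb p hp)
  · have hl : Tendsto (fun n => b + ⟪w - y, (s n).1⟫_ℝ + 1 / (2 * μ) * ‖(s n).1‖ ^ 2) atTop
        (𝓝 (b + ⟪w - y, u⟫_ℝ + 1 / (2 * μ) * ‖u‖ ^ 2)) :=
      ((tendsto_const_nhds.inner hu).const_add b).add ((hu.norm.pow 2).const_mul _)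
    refine le_of_tendsto_of_tendsto' hl hslim fun n => ?_
    have := hw _ (hs n)
    simp only [proxValue, inner_sub_left]
    linarith

/-- One inexact proximal step: distance estimates with respect to a dual solution `w`. -/
theorem exists_exact_dual_step [CompleteSpace F] {S : Set (F × ℝ)} (hS : Convex ℝ S) {Φ : ℝ}
    (h0 : ((0 : F), Φ) ∈ S) {w : F} (hw : ∀ p ∈ S, Φ + ⟪w, p.1⟫_ℝ ≤ p.2)
    {μ : ℝ} (hμ : 0 < μ) (y : F) {ε : ℝ} {p : F × ℝ} (hp : p ∈ S)
    (hopt : ∀ q ∈ S, proxValue μ y p ≤ proxValue μ y q + ε) :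
    ∃ (m : ℝ) (d : F),
      (∀ q ∈ S, m + ⟪y - d, q.1⟫_ℝ ≤ q.2) ∧
      Φ - ‖w - y‖ * (μ * ‖d‖) ≤ m ∧
      ‖μ⁻¹ • p.1 - d‖ ≤ √2 * √(ε / μ) ∧
      ∀ w' : F, (∀ q ∈ S, Φ + ⟪w', q.1⟫_ℝ ≤ q.2) →
        ‖y - d - w'‖ ^ 2 + ‖d‖ ^ 2 ≤ ‖y - w'‖ ^ 2 := by
  have hB : ∀ q ∈ S, proxValue μ y p - ε ≤ proxValue μ y q := fun q hq => by
    linarith [hopt q hq]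
  obtain ⟨m, u, hgrow, hinf, haff⟩ := exists_proximal_point hS ⟨_, h0⟩ hμ y hB
  have hsupp : ∀ q ∈ S, m + 1 / (2 * μ) * ‖u‖ ^ 2 + ⟪y - μ⁻¹ • u, q.1⟫_ℝ ≤ q.2 := by
    intro q hq
    have h := hgrow q hq
    rw [norm_sub_sq_real, proxValue] at h
    rw [inner_sub_left, inner_smul_left, conj_trivial, real_inner_comm q.1 u]
    have e : 1 / (2 * μ) * (‖q.1‖ ^ 2 - 2 * ⟪q.1, u⟫_ℝ + ‖u‖ ^ 2) =
      1 / (2 * μ) * ‖q.1‖ ^ 2 - μ⁻¹ * ⟪q.1, u⟫_ℝ + 1 / (2 * μ) * ‖u‖ ^ 2 := by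
      field_simp
    rw [e] at h
    linarith
  have hpos : 0 ≤ 1 / (2 * μ) * ‖u‖ ^ 2 := by positivity
  have hmd : μ * ‖μ⁻¹ • u‖ = ‖u‖ := by
    rw [norm_smul, Real.norm_of_nonneg (inv_nonneg.2 hμ.le), mul_inv_cancel_left₀ hμ.ne']
  refine ⟨m, μ⁻¹ • u, fun q hq => by linarith [hsupp q hq], ?_, ?_, fun w' hw' => ?_⟩
  · have h1 := haff Φ w hw
    have h2 := neg_le_of_abs_le (abs_real_inner_le_norm (w - y) u)
    rw [hmd]
    linarith
  · have h1 := hgrow p hp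
    have h2 := hinf _ hB
    rw [← smul_sub, norm_smul, Real.norm_of_nonneg (inv_nonneg.2 hμ.le),
      ← Real.sqrt_mul (by norm_num)]
    refine Real.le_sqrt_of_sq_le ?_
    have h3 : 1 / (2 * μ) * ‖p.1 - u‖ ^ 2 ≤ ε := by linarith
    calc (μ⁻¹ * ‖p.1 - u‖) ^ 2 = 2 / μ * (1 / (2 * μ) * ‖p.1 - u‖ ^ 2) := by field_simp
      _ ≤ 2 / μ * ε := by gcongr
      _ = 2 * (ε / μ) := by ring
  -- Adding the minorant bound at `u` to the support inequality at `(0, Φ)` eliminates `m` and gives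
  -- `⟪y - w', d⟫ ≥ ‖d‖ ^ 2`.
  · have h1 := haff Φ w' hw'
    have h2 := hsupp _ h0
    simp only [inner_zero_right, add_zero] at h2
    have hu : u = μ • (μ⁻¹ • u) := by rw [smul_inv_smul₀ hμ.ne']
    set d := μ⁻¹ • u
    rw [hu, norm_smul, Real.norm_of_nonneg hμ.le, inner_smul_right] at h1
    rw [hu, norm_smul, Real.norm_of_nonneg hμ.le] at h2
    have h3 : μ * (⟪w' - y, d⟫_ℝ + ‖d‖ ^ 2) ≤ μ * 0 := by
      have e : 1 / (2 * μ) * (μ * ‖d‖) ^ 2 = μ * ‖d‖ ^ 2 / 2 := by field_simp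
      rw [e] at h1 h2
      linarith
    have h4 := le_of_mul_le_mul_left h3 hμ
    have h5 : ‖y - d - w'‖ ^ 2 = ‖y - w'‖ ^ 2 - 2 * ⟪y - w', d⟫_ℝ + ‖d‖ ^ 2 := by
      rw [sub_right_comm, norm_sub_sq_real]
    rw [h5]
    have h6 : ⟪w' - y, d⟫_ℝ = -⟪y - w', d⟫_ℝ := by rw [← inner_neg_left, neg_sub]
    linarith

end ProximalStep

/-! ### Convergence of the inexact dual iteration. -/

/-- Subtracting the partial sums of `e` turns `a` into a decreasing sequence that is bounded below.
-/
theorem tendsto_of_le_add_summable {a e : ℕ → ℝ} (ha : ∀ k, 0 ≤ a k) (he0 : ∀ k, 0 ≤ e k)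
    (he : Summable e) (h : ∀ k, a (k + 1) ≤ a k + e k) : ∃ l, Tendsto a atTop (𝓝 l) := by
  have hanti : Antitone fun k => a k - ∑ i ∈ Finset.range k, e i :=
    antitone_nat_of_succ_le fun k => by
      rw [Finset.sum_range_succ]
      linarith [h k]
  have hb : BddBelow (range fun k => a k - ∑ i ∈ Finset.range k, e i) :=
    ⟨-∑' i, e i, by
      rintro _ ⟨k, rfl⟩
      have := he.sum_le_tsum (Finset.range k) fun i _ => he0 i
      simp only
      linarith [ha k]⟩
  refine ⟨_, ((tendsto_atTop_ciInf hanti hb).add he.hasSum.tendsto_sum_nat).congr fun k => ?_⟩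
  ring

/-- Convergence of the inexact proximal method that is dual to the augmented Lagrangian method,
stated for a convex set `S` of pairs (perturbation, attainable value). -/
theorem tendsto_inexact_dual_steps {F : Type*} [NormedAddCommGroup F] [InnerProductSpace ℝ F]
    [FiniteDimensional ℝ F] {S : Set (F × ℝ)} (hS : Convex ℝ S) {Φ M : ℝ}
    (h0 : ((0 : F), Φ) ∈ S) {w : F} (hw : ∀ q ∈ S, Φ + ⟪w, q.1⟫_ℝ ≤ q.2)
    {μ ε : ℕ → ℝ} (hμ : ∀ k, 0 < μ k) (hμM : ∀ k, μ k ≤ M) (hε : ∀ k, 0 ≤ ε k)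
    {y : ℕ → F} {p : ℕ → F × ℝ} (hp : ∀ k, p k ∈ S)
    (hopt : ∀ k, ∀ q ∈ S, proxValue (μ k) (y k) (p k) ≤ proxValue (μ k) (y k) q + ε k)
    (hy : ∀ k, y (k + 1) = y k - (μ k)⁻¹ • (p k).1)
    (hsum : Summable fun k => √(ε k / μ k)) :
    (∃ ybar, (∀ q ∈ S, Φ + ⟪ybar, q.1⟫_ℝ ≤ q.2) ∧ Tendsto y atTop (𝓝 ybar)) ∧
    Tendsto (fun k => (p k).1) atTop (𝓝 0) ∧
    ∃ δ : ℕ → ℝ, Tendsto δ atTop (𝓝 0) ∧ ∀ k, (p k).2 ≤ Φ + δ k := by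
  choose m d hsupp hm herr hfejer using fun k =>
    exists_exact_dual_step hS h0 hw (hμ k) (y k) (hp k) (hopt k)
  have hsum2 : Summable fun k => √2 * √(ε k / μ k) := hsum.mul_left _
  have hlim : ∀ w' : F, (∀ q ∈ S, Φ + ⟪w', q.1⟫_ℝ ≤ q.2) →
      ∃ l, Tendsto (fun k => ‖y k - w'‖) atTop (𝓝 l) ∧
        Tendsto (fun k => ‖y k - d k - w'‖) atTop (𝓝 l) := by
    intro w' hw'
    have hle : ∀ k, ‖y k - d k - w'‖ ≤ ‖y k - w'‖ := fun k => by
      refine le_of_sq_le_sq ?_ (norm_nonneg _)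
      nlinarith [hfejer k w' hw', sq_nonneg ‖d k‖]
    have hge : ∀ k, ‖y (k + 1) - w'‖ ≤ ‖y k - d k - w'‖ + √2 * √(ε k / μ k) := fun k => by
      have e : y (k + 1) - w' = (y k - d k - w') - ((μ k)⁻¹ • (p k).1 - d k) := by
        rw [hy k]; abel
      rw [e]
      exact (norm_sub_le _ _).trans (by gcongr; exact herr k)
    obtain ⟨l, hl⟩ := tendsto_of_le_add_summable (fun k => norm_nonneg (y k - w'))
      (fun k => by positivity) hsum2 fun k => (hge k).trans (by gcongr; exact hle k)
    refine ⟨l, hl, tendsto_of_tendsto_of_tendsto_of_le_of_le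
      (g := fun k => ‖y (k + 1) - w'‖ - √2 * √(ε k / μ k)) ?_ hl
      (fun k => by linarith [hge k]) hle⟩
    simpa using (hl.comp (tendsto_add_atTop_nat 1)).sub hsum2.tendsto_atTop_zero
  -- Distances before and after the exact step share a limit, so the Fejér gap `‖d k‖ ^ 2` vanishes.
  have hd : Tendsto d atTop (𝓝 0) := by
    obtain ⟨l, h1, h2⟩ := hlim w hw
    have h3 : Tendsto (fun k => ‖d k‖ ^ 2) atTop (𝓝 0) :=
      squeeze_zero (g := fun k => ‖y k - w‖ ^ 2 - ‖y k - d k - w‖ ^ 2) (fun k => sq_nonneg _)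
        (fun k => by linarith [hfejer k w hw]) (by simpa using (h1.pow 2).sub (h2.pow 2))
    rw [tendsto_zero_iff_norm_tendsto_zero]
    simpa using h3.sqrt
  have hM : 0 ≤ M := (hμ 0).le.trans (hμM 0)
  have hstep : Tendsto (fun k => (μ k)⁻¹ • (p k).1) atTop (𝓝 0) := by
    have := (squeeze_zero_norm herr hsum2.tendsto_atTop_zero).add hd
    simpa using this
  have hpert : Tendsto (fun k => (p k).1) atTop (𝓝 0) := by
    refine squeeze_zero_norm (a := fun k => M * ‖(μ k)⁻¹ • (p k).1‖) (fun k => ?_)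
      (by simpa using hstep.norm.const_mul M)
    rw [norm_smul, Real.norm_of_nonneg (inv_nonneg.2 (hμ k).le), ← mul_assoc]
    refine le_mul_of_one_le_left (norm_nonneg _) ?_
    rw [← div_eq_mul_inv, one_le_div (hμ k)]
    exact hμM k
  obtain ⟨lw, hlw, -⟩ := hlim w hw
  obtain ⟨R, hR⟩ := hlw.bddAbove_range
  replace hR : ∀ k, ‖y k - w‖ ≤ R := fun k => hR ⟨k, rfl⟩
  have hR0 : 0 ≤ R := (norm_nonneg _).trans (hR 0)
  have hmlow : ∀ k, Φ - R * (M * ‖d k‖) ≤ m k := fun k => by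
    refine le_trans ?_ (hm k)
    have := hR k
    rw [norm_sub_rev] at this
    have := hμM k
    have := (hμ k).le
    gcongr
  obtain ⟨ybar, -, φ, hφ, hyφ⟩ := tendsto_subseq_of_bounded (Metric.isBounded_closedBall (x := w))
    (fun k => by rw [Metric.mem_closedBall, dist_eq_norm]; exact hR k : ∀ k, y k ∈ _)
  -- Pass to the limit in the minorants with slope `y k - d k`; their intercepts are asymptotically
  -- at least `Φ`.
  have hbar : ∀ q ∈ S, Φ + ⟪ybar, q.1⟫_ℝ ≤ q.2 := by
    intro q hq
    have hd' := hd.comp hφ.tendsto_atTop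
    have h1 : Tendsto (fun j => Φ - R * (M * ‖d (φ j)‖) + ⟪y (φ j) - d (φ j), q.1⟫_ℝ) atTop
        (𝓝 (Φ - R * (M * ‖(0 : F)‖) + ⟪ybar - 0, q.1⟫_ℝ)) :=
      (((hd'.norm.const_mul M).const_mul R).const_sub Φ).add
        ((hyφ.sub hd').inner tendsto_const_nhds)
    have h2 := le_of_tendsto' h1 fun j => by
      have := hsupp (φ j) q hq
      have := hmlow (φ j)
      show _ ≤ q.2
      linarith
    simpa using h2
  have hyconv : Tendsto y atTop (𝓝 ybar) := by
    obtain ⟨l, hl, -⟩ := hlim ybar hbar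
    have h1 : Tendsto (fun j => ‖y (φ j) - ybar‖) atTop (𝓝 0) := by
      rw [← tendsto_iff_norm_sub_tendsto_zero]; exact hyφ
    rw [tendsto_iff_norm_sub_tendsto_zero]
    rwa [tendsto_nhds_unique (hl.comp hφ.tendsto_atTop) h1] at hl
  -- This `δ` comes from comparing `p k` with `(0, Φ)` and dropping the quadratic term.
  refine ⟨⟨ybar, hbar, hyconv⟩, hpert, fun k => ε k + ⟪y k, (p k).1⟫_ℝ, ?_, fun k => ?_⟩
  · have hε0 : Tendsto ε atTop (𝓝 0) := by
      refine squeeze_zero hε (g := fun k => M * √(ε k / μ k) ^ 2) (fun k => ?_)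
        (by simpa using (hsum.tendsto_atTop_zero.pow 2).const_mul M)
      rw [Real.sq_sqrt (div_nonneg (hε k) (hμ k).le)]
      calc ε k = μ k * (ε k / μ k) := by rw [mul_div_cancel₀ _ (hμ k).ne']
        _ ≤ M * (ε k / μ k) := by
          have := hμM k
          have := div_nonneg (hε k) (hμ k).le
          gcongr
    simpa using hε0.add (hyconv.inner hpert)
  · have h := hopt k _ h0
    have : 0 ≤ 1 / (2 * μ k) * ‖(p k).1‖ ^ 2 := by
      have := hμ k
      positivity
    simp only [proxValue, inner_zero_right, norm_zero] at h
    simp only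
    linarith

/-! ### Convex-analytic tools. -/

theorem inner_le_zero_of_mem_horizon {F : Type*} [NormedAddCommGroup F]
    [InnerProductSpace ℝ F] {φ : F → EReal} {a y v : F} (hy : y ∈ subdiff φ a)
    (hbot : φ a ≠ ⊥) (hv : v ∈ horizon φ) : ⟪y, v⟫_ℝ ≤ 0 := by
  obtain ⟨ha, hy⟩ := hy
  have h1 := hv a ha
  have h2 := (hy (a + v) (h1.trans_lt ha)).trans h1
  rw [add_sub_cancel_left] at h2
  lift φ a to ℝ using ⟨ne_of_lt ha, hbot⟩ with γ
  have : γ + ⟪y, v⟫_ℝ ≤ γ := by exact_mod_cast h2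
  linarith

theorem IsProx.ne_top {F : Type*} [NormedAddCommGroup F] {φ : F → EReal} {γ : ℝ}
    {a p : F} (h : IsProx φ γ a p) (hφ : IsProperFun φ) : φ p ≠ ⊤ := by
  obtain ⟨w, hw⟩ := hφ.1
  intro htop
  have := h w
  rw [htop, EReal.top_add_coe, top_le_iff] at this
  exact (EReal.add_lt_top (ne_of_lt hw) (EReal.coe_ne_top _)).ne this

theorem ConvexOn.le_of_hasFDerivAt_zero {E : Type*} [NormedAddCommGroup E] [NormedSpace ℝ E]
    {f : E → ℝ} (hf : ConvexOn ℝ univ f) {a : E} (h : HasFDerivAt f (0 : E →L[ℝ] ℝ) a) (x : E) :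
    f a ≤ f x := by
  have hline : HasDerivAt (fun t : ℝ => f (AffineMap.lineMap a x t)) 0 0 := by
    have h0 : HasFDerivAt f (0 : E →L[ℝ] ℝ) (AffineMap.lineMap a x (0 : ℝ)) := by simpa using h
    simpa [Function.comp_def] using h0.comp_hasDerivAt (0 : ℝ) AffineMap.hasDerivAt_lineMap
  have hconv : ConvexOn ℝ univ (fun t : ℝ => f (AffineMap.lineMap a x t)) := by
    simpa [Function.comp_def] using hf.comp_affineMap (AffineMap.lineMap a x : ℝ →ᵃ[ℝ] E)
  have := hconv.le_slope_of_hasDerivAt (mem_univ 0) (mem_univ 1) zero_lt_one hline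
  simpa [slope_def_field] using this

/-! ### Perturbed values, augmented Lagrangian and multipliers. -/

namespace CompositeProblem

theorem IsMinimizer.optVal_eq {E F : Type*} {P : CompositeProblem E F} {a : E}
    (h : P.IsMinimizer a) :
    P.optVal = P.obj a :=
  le_antisymm (iInf_le _ a) (le_iInf h.2)

/-- Lower semicontinuity along a convergent sequence of nearly feasible, nearly optimal points. -/
theorem isMinimizer_and_tendsto_of_tendsto {E F : Type*} [NormedAddCommGroup E]
    [NormedAddCommGroup F] {P : CompositeProblem E F} (hf : Continuous P.f)
    (hg : LowerSemicontinuous P.g) {Φ : ℝ} (hΦ : P.optVal = Φ) {x : ℕ → E} {z : ℕ → F}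
    {r δ : ℕ → ℝ} {xbar : E} (hx : Tendsto x atTop (𝓝 xbar))
    (hz : Tendsto z atTop (𝓝 (P.c xbar))) (hr : ∀ j, P.g (z j) = ((r j - P.f (x j) : ℝ) : EReal))
    (hδ : Tendsto δ atTop (𝓝 0)) (hrδ : ∀ j, r j ≤ Φ + δ j) :
    P.IsMinimizer xbar ∧ Tendsto r atTop (𝓝 Φ) := by
  have hfx : Tendsto (fun j => P.f (x j)) atTop (𝓝 (P.f xbar)) := (hf.tendsto xbar).comp hx
  have hlsc : ∀ t : ℝ, (t : EReal) < P.g (P.c xbar) → ∀ᶠ j in atTop, t < r j - P.f (x j) := by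
    intro t ht
    filter_upwards [hz.eventually (hg _ _ ht)] with j hj
    rw [hr] at hj
    exact_mod_cast hj
  have hub : Tendsto (fun j => Φ + δ j) atTop (𝓝 Φ) := by simpa using hδ.const_add Φ
  have hupper : P.g (P.c xbar) ≤ ((Φ - P.f xbar : ℝ) : EReal) := by
    by_contra! hlt
    obtain ⟨t, ht1, ht2⟩ := EReal.lt_iff_exists_real_btwn.1 hlt
    have h1 : t ≤ Φ - P.f xbar := by
      refine ge_of_tendsto (hub.sub hfx) ?_
      filter_upwards [hlsc t ht2] with j hj
      linarith [hrδ j]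
    exact absurd (EReal.coe_lt_coe_iff.1 ht1) (not_lt.2 h1)
  have hobj : P.obj xbar ≤ Φ := by
    calc P.obj xbar ≤ (P.f xbar : EReal) + ((Φ - P.f xbar : ℝ) : EReal) :=
          add_le_add_right hupper _
      _ = Φ := by rw [← EReal.coe_add, add_sub_cancel]
  refine ⟨⟨hobj.trans_lt (EReal.coe_lt_top _), fun x' => hobj.trans (hΦ ▸ iInf_le _ x')⟩, ?_⟩
  have hlower : ((Φ - P.f xbar : ℝ) : EReal) ≤ P.g (P.c xbar) := by
    by_contra! hlt
    have h1 : P.obj xbar < Φ := by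
      calc P.obj xbar < (P.f xbar : EReal) + ((Φ - P.f xbar : ℝ) : EReal) :=
            EReal.add_lt_add_left_coe hlt _
        _ = Φ := by rw [← EReal.coe_add, add_sub_cancel]
    exact absurd (hΦ ▸ iInf_le P.obj xbar : (Φ : EReal) ≤ P.obj xbar) (not_le.2 h1)
  refine tendsto_order.2 ⟨fun b hb => ?_, fun b hb => ?_⟩
  -- The gap `Φ - b` is split evenly between the `g` and `f` terms.
  · have ht : (((Φ + b) / 2 - P.f xbar : ℝ) : EReal) < P.g (P.c xbar) :=
      (EReal.coe_lt_coe_iff.2 (by linarith)).trans_le hlower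
    have hf' : ∀ᶠ j in atTop, P.f xbar - (Φ - b) / 2 < P.f (x j) :=
      hfx.eventually (lt_mem_nhds (by linarith))
    filter_upwards [hlsc _ ht, hf'] with j h1 h2
    linarith
  · filter_upwards [hub.eventually (gt_mem_nhds hb)] with j hj
    exact (hrδ j).trans_lt hj

variable {E F : Type*} [NormedAddCommGroup F] [InnerProductSpace ℝ F]

/-- Pairs `(u, r)` such that the value `r` can be attained, or improved, in the problem whose
constraint map is perturbed by `u`. -/
def perturbedValues (P : CompositeProblem E F) : Set (F × ℝ) :=
  {q | ∃ x, P.g (P.c x + q.1) ≤ ((q.2 - P.f x : ℝ) : EReal)}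

theorem exists_augLagrangian_le (P : CompositeProblem E F) (μ : ℝ) (y : F) {q : F × ℝ}
    (hq : q ∈ P.perturbedValues) : ∃ x, P.augLagrangian μ x y ≤ (proxValue μ y q : EReal) := by
  obtain ⟨x, hx⟩ := hq
  refine ⟨x, ?_⟩
  calc P.augLagrangian μ x y
      ≤ (P.f x : EReal) + (P.g (P.c x + q.1) + ((⟪y, P.c x - (P.c x + q.1)⟫_ℝ +
          1 / (2 * μ) * ‖P.c x - (P.c x + q.1)‖ ^ 2 : ℝ) : EReal)) :=
        add_le_add_right (iInf_le _ _) _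
    _ ≤ (P.f x : EReal) + (((q.2 - P.f x : ℝ) : EReal) + ((⟪y, P.c x - (P.c x + q.1)⟫_ℝ +
          1 / (2 * μ) * ‖P.c x - (P.c x + q.1)‖ ^ 2 : ℝ) : EReal)) := by gcongr
    _ = (proxValue μ y q : EReal) := by
      rw [← EReal.coe_add, ← EReal.coe_add, EReal.coe_eq_coe_iff, sub_add_cancel_left,
        inner_neg_right, norm_neg, proxValue]
      ring

/-- Completing the square turns the prox objective into the inner objective plus `μ / 2 * ‖y‖ ^ 2`,
so the prox point attains the inner infimum. -/
theorem le_augLagrangian_of_isProx {P : CompositeProblem E F} (hbot : ∀ z, P.g z ≠ ⊥) {μ : ℝ}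
    (hμ : 0 < μ) {x : E} {y z : F} {γ : ℝ} (hγ : P.g z = γ)
    (hz : IsProx P.g μ (P.c x + μ • y) z) :
    (proxValue μ y (z - P.c x, P.f x + γ) : EReal) ≤ P.augLagrangian μ x y := by
  have key : ∀ w : F, 1 / (2 * μ) * ‖w - (P.c x + μ • y)‖ ^ 2 =
      ⟪y, P.c x - w⟫_ℝ + 1 / (2 * μ) * ‖P.c x - w‖ ^ 2 + μ / 2 * ‖y‖ ^ 2 := by
    intro w
    have e : w - (P.c x + μ • y) = -((P.c x - w) + μ • y) := by abel
    rw [e, norm_neg, norm_add_sq_real, norm_smul, inner_smul_right, Real.norm_of_nonneg hμ.le,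
      real_inner_comm]
    field_simp
    ring
  have e : proxValue μ y (z - P.c x, P.f x + γ) =
      P.f x + (γ + (⟪y, P.c x - z⟫_ℝ + 1 / (2 * μ) * ‖P.c x - z‖ ^ 2)) := by
    rw [proxValue, ← neg_sub z (P.c x), inner_neg_right, norm_neg]
    ring
  rw [e, EReal.coe_add]
  refine add_le_add_right (le_iInf fun w => ?_) _
  have h := hz w
  rw [hγ, key, key] at h
  rcases eq_or_ne (P.g w) ⊤ with hw | hw
  · rw [hw, EReal.top_add_coe]
    exact le_top
  · rw [← EReal.coe_toReal hw (hbot w)] at h ⊢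
    rw [← EReal.coe_add, ← EReal.coe_add, EReal.coe_le_coe_iff] at h
    rw [← EReal.coe_add, EReal.coe_le_coe_iff]
    linarith

theorem IsClassicalALM.penalty_pos {P : CompositeProblem E F} {β : ℝ} {μ ε : ℕ → ℝ}
    {x : ℕ → E} {z y : ℕ → F} (h : P.IsClassicalALM β μ ε x z y) (k : ℕ) : 0 < μ k := by
  induction k with
  | zero => exact h.μ_zero_pos
  | succ k ih =>
    obtain ⟨b, hb | rfl, hk⟩ := h.penalty_step k
    · rw [hk]
      exact mul_pos hb.1 ih
    · rwa [hk, one_mul]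

theorem IsClassicalALM.penalty_antitone {P : CompositeProblem E F} {β : ℝ} {μ ε : ℕ → ℝ}
    {x : ℕ → E} {z y : ℕ → F} (h : P.IsClassicalALM β μ ε x z y) : Antitone μ := by
  refine antitone_nat_of_succ_le fun k => ?_
  have hpos := h.penalty_pos k
  obtain ⟨b, hb | rfl, hk⟩ := h.penalty_step k
  · rw [hk]
    exact mul_le_of_le_one_left hpos.le (hb.2.trans h.β_mem.2.le)
  · rw [hk, one_mul]

variable [NormedAddCommGroup E] [InnerProductSpace ℝ E]

/-- The convexity defect of `c` is a horizon direction, so adding it to the averaged argument does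
not increase `g`. -/
theorem IsFullyConvex.convex_perturbedValues {P : CompositeProblem E F} (hP : P.IsFullyConvex) :
    Convex ℝ P.perturbedValues := by
  rintro ⟨u₁, r₁⟩ ⟨x₁, h₁⟩ ⟨u₂, r₂⟩ ⟨x₂, h₂⟩ t s ht hs hts
  obtain rfl : s = 1 - t := by linarith
  have hg : P.g (t • (P.c x₁ + u₁) + (1 - t) • (P.c x₂ + u₂)) ≤
      ((t * (r₁ - P.f x₁) + (1 - t) * (r₂ - P.f x₂) : ℝ) : EReal) := by
    have h := hP.g_convex (x := (P.c x₁ + u₁, r₁ - P.f x₁)) (y := (P.c x₂ + u₂, r₂ - P.f x₂))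
      h₁ h₂ ht hs hts
    simpa using h
  have hf := hP.f_convex.2 (mem_univ x₁) (mem_univ x₂) ht hs hts
  have hc := hP.c_convex x₁ x₂ t ⟨ht, by linarith⟩ _ (hg.trans_lt (EReal.coe_lt_top _))
  refine ⟨t • x₁ + (1 - t) • x₂, ?_⟩
  have e : P.c (t • x₁ + (1 - t) • x₂) + (t • u₁ + (1 - t) • u₂) =
      t • (P.c x₁ + u₁) + (1 - t) • (P.c x₂ + u₂) +
        (P.c (t • x₁ + (1 - t) • x₂) - t • P.c x₁ - (1 - t) • P.c x₂) := by
    simp only [smul_add]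
    abel
  simp only [Prod.fst_add, Prod.smul_fst, Prod.snd_add, Prod.smul_snd, smul_eq_mul]
  rw [e]
  refine (hc.trans hg).trans (EReal.coe_le_coe_iff.2 ?_)
  simp only [smul_eq_mul] at hf
  linarith

/-- A subgradient pairs nonpositively with the convexity defect of `c`. -/
theorem convexOn_lagrangian {P : CompositeProblem E F} (hP : P.IsFullyConvex) {a : E} {y : F}
    (hy : y ∈ subdiff P.g (P.c a)) : ConvexOn ℝ univ fun x => P.f x + ⟪y, P.c x⟫_ℝ := by
  refine hP.f_convex.add ⟨convex_univ, fun x₁ _ x₂ _ t s ht hs hts => ?_⟩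
  obtain rfl : s = 1 - t := by linarith
  have h := inner_le_zero_of_mem_horizon hy (hP.g_proper.2 _)
    (hP.c_convex x₁ x₂ t ⟨ht, by linarith⟩)
  simp only [inner_sub_right, inner_smul_right] at h
  simp only [smul_eq_mul]
  linarith

/-- At a minimizer, the multipliers are the slopes of the affine minorants of the perturbed
values that are exact at the unperturbed problem. -/
theorem mem_multipliers_iff {P : CompositeProblem E F} (hP : P.IsFullyConvex) {a : E} {γ : ℝ}
    (hγ : P.g (P.c a) = γ) {y : F} :
    y ∈ P.multipliers a ↔ ∀ q ∈ P.perturbedValues, P.f a + γ + ⟪y, q.1⟫_ℝ ≤ q.2 := by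
  constructor
  · rintro ⟨hy, hder⟩ ⟨u, r⟩ ⟨x, hx⟩
    have h1 := (convexOn_lagrangian hP hy).le_of_hasFDerivAt_zero hder x
    have h2 := (hy.2 _ (hx.trans_lt (EReal.coe_lt_top _))).trans hx
    rw [hγ] at h2
    have h3 : γ + ⟪y, P.c x + u - P.c a⟫_ℝ ≤ r - P.f x := by exact_mod_cast h2
    simp only [inner_sub_right, inner_add_right] at h3
    simp only at h1 ⊢
    linarith
  · intro h
    refine ⟨⟨by simp [effDomain, hγ], fun z hz => ?_⟩, ?_⟩
    · rw [hγ]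
      have hz' : P.g z = ((P.g z).toReal : EReal) :=
        (EReal.coe_toReal (ne_of_lt hz) (hP.g_proper.2 z)).symm
      -- Fixing `x = a` tests the subgradient inequality; the perturbation `P.c a - P.c x` below
      -- tests minimality in `x`.
      have h1 := h (z - P.c a, P.f a + (P.g z).toReal) ⟨a, by simp [← hz']⟩
      rw [hz', ← EReal.coe_add, EReal.coe_le_coe_iff]
      simp only at h1
      linarith
    · have hmin : IsLocalMin (fun x => P.f x + ⟪y, P.c x⟫_ℝ) a := by
        refine Eventually.of_forall fun x => ?_
        have h1 := h (P.c a - P.c x, P.f x + γ) ⟨x, by simp [hγ]⟩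
        simp only [inner_sub_right] at h1
        simp only
        linarith
      have hd : DifferentiableAt ℝ (fun x => P.f x + ⟪y, P.c x⟫_ℝ) a :=
        ((hP.f_contDiff.differentiable one_ne_zero) a).add
          ((differentiableAt_const y).inner ℝ ((hP.c_contDiff.differentiable one_ne_zero) a))
      have := hd.hasFDerivAt
      rwa [hmin.fderiv_eq_zero] at this

end CompositeProblem

/-! ### Application to the algorithm. -/

theorem theorem4p2 {E F : Type*}
    [NormedAddCommGroup E] [InnerProductSpace ℝ E] [FiniteDimensional ℝ E]
    [NormedAddCommGroup F] [InnerProductSpace ℝ F] [FiniteDimensional ℝ F]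
    (P : CompositeProblem E F) (hP : P.IsFullyConvex)
    -- a stationary minimizer, whose multiplier set is `Y_mul`
    (a : E) (ha_min : P.IsMinimizer a) (ha_stat : P.IsStationary a)
    (β : ℝ) (μ ε : ℕ → ℝ) (x : ℕ → E) (z y : ℕ → F)
    (hALM : P.IsClassicalALM β μ ε x z y)
    (hsum : Summable (fun k => √(ε k / μ k))) :
    (∃ ybar ∈ P.multipliers a, Tendsto y atTop (𝓝 ybar)) ∧
    Tendsto (fun k => P.c (x k) - z k) atTop (𝓝 0) ∧
    limsup (fun k => (P.f (x k) : EReal) + P.g (z k)) atTop ≤ P.optVal ∧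
    (∀ xbar, MapClusterPt xbar atTop x → P.IsMinimizer xbar) ∧
    (∀ (xbar : E) (φ : ℕ → ℕ), StrictMono φ →
      Tendsto (fun j => x (φ j)) atTop (𝓝 xbar) →
        Tendsto (fun j => z (φ j)) atTop (𝓝 (P.c xbar)) ∧
        Tendsto (fun j => (P.f (x (φ j)) : EReal) + P.g (z (φ j))) atTop (𝓝 P.optVal)) := by
  obtain ⟨w, hw⟩ := ha_stat
  obtain ⟨γ, hγ⟩ : ∃ γ : ℝ, P.g (P.c a) = γ :=
    ⟨_, (EReal.coe_toReal (ne_of_lt hw.1.1) (hP.g_proper.2 _)).symm⟩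
  have hΦ : P.optVal = ((P.f a + γ : ℝ) : EReal) := by
    rw [ha_min.optVal_eq, CompositeProblem.obj, hγ, EReal.coe_add]
  have hμ := hALM.penalty_pos
  have hgz : ∀ k, P.g (z k) = ((P.g (z k)).toReal : EReal) := fun k =>
    (EReal.coe_toReal ((hALM.prox_step k).ne_top hP.g_proper) (hP.g_proper.2 _)).symm
  set p : ℕ → F × ℝ := fun k => (z k - P.c (x k), P.f (x k) + (P.g (z k)).toReal) with hp
  have hgp : ∀ k, P.g (z k) = (((p k).2 - P.f (x k) : ℝ) : EReal) := fun k => by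
    rw [hp, add_sub_cancel_left, ← hgz]
  have hval : ∀ k, (P.f (x k) : EReal) + P.g (z k) = ((p k).2 : EReal) := fun k => by
    rw [hgp, ← EReal.coe_add, add_sub_cancel]
  have hopt : ∀ k, ∀ q ∈ P.perturbedValues,
      proxValue (μ k) (y k) (p k) ≤ proxValue (μ k) (y k) q + ε k := by
    intro k q hq
    obtain ⟨x', hx'⟩ := P.exists_augLagrangian_le (μ k) (y k) hq
    have h1 := CompositeProblem.le_augLagrangian_of_isProx hP.g_proper.2 (hμ k) (hgz k)
      (hALM.prox_step k)
    have h2 := (h1.trans (hALM.subproblem k)).trans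
      (add_le_add_left ((iInf_le _ x').trans hx') _)
    exact_mod_cast h2
  obtain ⟨⟨ybar, hybar, hylim⟩, hpert, δ, hδ, hpδ⟩ :=
    tendsto_inexact_dual_steps hP.convex_perturbedValues
      (show ((0 : F), P.f a + γ) ∈ P.perturbedValues from ⟨a, by simp [hγ]⟩)
      ((CompositeProblem.mem_multipliers_iff hP hγ).1 hw) hμ
      (fun k => hALM.penalty_antitone (Nat.zero_le k)) hALM.ε_nonneg
      (fun k => ⟨x k, by rw [← hgp]; simp [hp]⟩) hopt
      (fun k => by rw [hALM.dual_step, ← neg_sub (z k), smul_neg, ← sub_eq_add_neg]) hsum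
  have hsub : ∀ (xbar : E) (φ : ℕ → ℕ), StrictMono φ →
      Tendsto (fun j => x (φ j)) atTop (𝓝 xbar) →
        Tendsto (fun j => z (φ j)) atTop (𝓝 (P.c xbar)) ∧ P.IsMinimizer xbar ∧
        Tendsto (fun j => (p (φ j)).2) atTop (𝓝 (P.f a + γ)) := by
    intro xbar φ hφ hx
    have hz : Tendsto (fun j => z (φ j)) atTop (𝓝 (P.c xbar)) := by
      simpa [hp] using (hpert.comp hφ.tendsto_atTop).add
        ((hP.c_contDiff.continuous.tendsto xbar).comp hx)
    exact ⟨hz, CompositeProblem.isMinimizer_and_tendsto_of_tendsto hP.f_contDiff.continuous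
      hP.g_lsc hΦ hx hz (fun j => hgp (φ j)) (hδ.comp hφ.tendsto_atTop) fun j => hpδ (φ j)⟩
  refine ⟨⟨ybar, (CompositeProblem.mem_multipliers_iff hP hγ).2 hybar, hylim⟩, ?_, ?_, ?_, ?_⟩
  · simpa [hp] using hpert.neg
  · have hlim : Tendsto (fun k => ((P.f a + γ + δ k : ℝ) : EReal)) atTop (𝓝 P.optVal) := by
      rw [hΦ, EReal.tendsto_coe]
      simpa using hδ.const_add (P.f a + γ)
    rw [← hlim.limsup_eq]
    refine limsup_le_limsup (Eventually.of_forall fun k => ?_)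
    simp only [hval]
    exact EReal.coe_le_coe_iff.2 (hpδ k)
  · intro xbar hx
    obtain ⟨φ, hφ, hlim⟩ := hx.tendsto_subseq
    exact (hsub xbar φ hφ hlim).2.1
  · intro xbar φ hφ hx
    obtain ⟨hz, -, hr⟩ := hsub xbar φ hφ hx
    refine ⟨hz, ?_⟩
    simp only [hval, hΦ]
    exact EReal.tendsto_coe.2 hr
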